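/- Let $\mathbb{P}_{\rm Bm}$ be the law on $C([0,1])$ of a standard Brownian motion. For $\mathsf a,\mathsf c\in\mathbb R$ let $\eta^{(\mathsf a,\mathsf c)}=(\eta^{(\mathsf a,\mathsf c)}_t)_{t\in[0,1]}$ be a process whose law on $C([0,1])$ is given by $$\frac{d\mathbb P_{\eta^{(\mathsf a,\mathsf c)}}}{d\mathbb P_{\rm Bm}}(\omega)=\frac{e^{(\mathsf a+\mathsf c)\min_{t\in[0,1]}\omega_t-\mathsf a\,\omega_1}}{\mathbb E_{\rm Bm}\left[e^{(\mathsf a+\mathsf c)\min_{t\in[0,1]}\omega_t-\mathsf a\,\omega_1}\right]},\qquad \omega\in C([0,1]).$$ Fix $d\ge 1$, $(c_1,\dots,c_d)\in\mathbb R^d$ and times $0<t_1<\cdots<t_d=1$. Then for all $\mathsf a,\mathsf c\in\mathbb R$ this formula defines a probability measure on $C([0,1])$ and the Laplace transform $$\psi^{(\mathsf a,\mathsf c)}_{t_1,\dots,t_d}(c_1,\dots,c_d):=\mathbb E\left[\exp\left(-\sum_{k=1}^d c_k\,\eta^{(\mathsf a,\mathsf c)}_{t_k}\right)\right]$$ is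 finite; moreover, it is a continuous function of $(\mathsf a,\mathsf c)\in\mathbb R^2$. -/

import Mathlib

open MeasureTheory ProbabilityTheory
open scoped unitInterval

/-- The path space `C([0,1])` carries the Borel σ-algebra of the uniform topology. -/
instance pathMeasurableSpace : MeasurableSpace C(I, ℝ) := borel C(I, ℝ)

instance pathBorelSpace : BorelSpace C(I, ℝ) := ⟨rfl⟩

/-- `W` is the law on `C([0,1])` of a standard Brownian motion: under `W` the coordinate process
starts at `0`, has independent increments, and for `s ≤ t` its increment over `[s, t]` is a centered
Gaussian of variance `t - s` (continuity of the paths is built into `C([0,1])`). -/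
structure IsWienerMeasure (W : Measure C(I, ℝ)) : Prop where
  isProbabilityMeasure : IsProbabilityMeasure W
  start_zero : ∀ᵐ ω ∂W, ω 0 = 0
  indep_increments : HasIndepIncrements (fun (t : I) (ω : C(I, ℝ)) => ω t) W
  law_increment : ∀ s t : I, s ≤ t →
    HasLaw (fun ω : C(I, ℝ) => ω t - ω s) (gaussianReal 0 (Real.toNNReal ((t : ℝ) - s))) W

/-- The exponent `(a + c) * min_{t ∈ [0,1]} ω_t - a * ω_1`. The infimum is attained, as `ω` is
continuous on the compact interval `[0,1]`. -/
noncomputable def etaExponent (a c : ℝ) (ω : C(I, ℝ)) : ℝ :=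
  (a + c) * (⨅ t : I, ω t) - a * ω 1

/-- The law on `C([0,1])` of the process `η^{(a,c)}`, for `W` the law of Brownian motion:
the measure with density `exp (etaExponent a c ω) / E_W[exp (etaExponent a c)]` with
respect to `W`. -/
noncomputable def etaLaw (W : Measure C(I, ℝ)) (a c : ℝ) : Measure C(I, ℝ) :=
  W.tilted (etaExponent a c)

/-- The Laplace transform `E[exp (-∑ k, v k * η^{(a,c)}_{t k})]`. -/
noncomputable def etaLaplace (W : Measure C(I, ℝ)) {d : ℕ} (t : Fin d → I) (v : Fin d → ℝ)
    (a c : ℝ) : ℝ :=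
  ∫ ω, Real.exp (-∑ k, v k * ω (t k)) ∂(etaLaw W a c)

open Filter Topology BoundedContinuousFunction

/-! The Laplace transform is a ratio of two `W`-integrals whose integrands are at most `exp (K *
‖ω‖)`, with `K` locally bounded in `(a, c)`. Everything thus reduces to `integrable_exp_mul_norm`,
after which dominated convergence gives continuity. That bound follows from Fernique's theorem,
which needs only that `W.prod W` is rotation invariant; this passes to the limit from Bernstein
approximations of the path, which are centered Gaussian. -/

lemma bernsteinApproximation_eq_sum_smul (n : ℕ) (f : C(I, ℝ)) :
    bernsteinApproximation n f = ∑ k : Fin (n + 1), f (bernstein.z k) • bernstein n k := by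
  ext x
  simp [bernsteinApproximation.apply, mul_comm]

lemma continuous_bernsteinApproximation (n : ℕ) :
    Continuous (bernsteinApproximation n : C(I, ℝ) → C(I, ℝ)) := by
  simp_rw [funext (bernsteinApproximation_eq_sum_smul n)]
  fun_prop

/-- If a finite measure on `E` is approximated by its images under `T n`, with `T n → id` pointwise,
and the products of these images are invariant under a rotation, then so is its own product. -/
lemma map_rotation_prod_eq_self_of_tendsto {E : Type*} [NormedAddCommGroup E] [NormedSpace ℝ E]
    [MeasurableSpace E] [BorelSpace E] [SecondCountableTopology E] {μ : Measure E}
    [IsFiniteMeasure μ] {T : ℕ → E → E} (hT : ∀ n, Measurable (T n))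
    (hT_lim : ∀ x, Tendsto (fun n ↦ T n x) atTop (𝓝 x)) {θ : ℝ}
    (h : ∀ n, ((μ.map (T n)).prod (μ.map (T n))).map (ContinuousLinearMap.rotation θ)
      = (μ.map (T n)).prod (μ.map (T n))) :
    (μ.prod μ).map (ContinuousLinearMap.rotation θ) = μ.prod μ := by
  have hlim : ∀ g : E × E →ᵇ ℝ,
      Tendsto (fun n ↦ ∫ p, g p ∂((μ.map (T n)).prod (μ.map (T n)))) atTop
        (𝓝 (∫ p, g p ∂(μ.prod μ))) := by
    intro g
    have heq : ∀ n, ∫ p, g p ∂((μ.map (T n)).prod (μ.map (T n)))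
        = ∫ p, g (T n p.1, T n p.2) ∂(μ.prod μ) := by
      intro n
      rw [Measure.map_prod_map _ _ (hT n) (hT n),
        integral_map ((hT n).prodMap (hT n)).aemeasurable (by fun_prop)]
      rfl
    simp_rw [heq]
    refine tendsto_integral_of_dominated_convergence (fun _ ↦ ‖g‖) (fun n ↦ ?_)
      (integrable_const _) (fun n ↦ ae_of_all _ fun p ↦ g.norm_coe_le_norm _)
      (ae_of_all _ fun p ↦ ?_)
    · exact (g.continuous.measurable.comp
        ((hT n).prodMap (hT n))).aestronglyMeasurable
    · exact (g.continuous.tendsto _).comp ((hT_lim p.1).prodMk_nhds (hT_lim p.2))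
  refine ext_of_forall_integral_eq_of_IsFiniteMeasure fun g ↦ ?_
  rw [integral_map (by fun_prop) (by fun_prop)]
  -- By `h`, the integrals of `g` and of `g` composed with the rotation agree for each `n`, so their
  -- limits agree.
  refine tendsto_nhds_unique
    (hlim (g.compContinuous ⟨ContinuousLinearMap.rotation θ, by fun_prop⟩)) ?_
  convert! hlim g using 2 with n
  conv_rhs => rw [← h n]
  rw [integral_map (by fun_prop) (by fun_prop)]
  rfl

namespace IsWienerMeasure

variable {W : Measure C(I, ℝ)}

lemma hasLaw_eval (hW : IsWienerMeasure W) (t : I) :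
    HasLaw (fun ω : C(I, ℝ) ↦ ω t) (gaussianReal 0 (Real.toNNReal t)) W := by
  have h := hW.law_increment 0 t t.2.1
  simp only [Set.Icc.coe_zero, sub_zero] at h
  refine h.congr ?_
  filter_upwards [hW.start_zero] with ω hω
  simp [hω]

lemma isGaussianProcess (hW : IsWienerMeasure W) :
    IsGaussianProcess (fun (t : I) (ω : C(I, ℝ)) ↦ ω t) W :=
  hW.indep_increments.isGaussianProcess (fun t ↦ (hW.hasLaw_eval t).hasGaussianLaw) hW.start_zero

lemma integral_eval (hW : IsWienerMeasure W) (t : I) : ∫ ω : C(I, ℝ), ω t ∂W = 0 := by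
  rw [(hW.hasLaw_eval t).integral_eq, integral_id_gaussianReal]

/-- The approximation is a linear image of the path's values at finitely many nodes, which form a
Gaussian vector. -/
lemma isGaussian_map_bernsteinApproximation (hW : IsWienerMeasure W) (n : ℕ) :
    IsGaussian (W.map (bernsteinApproximation n)) := by
  have h := (hW.isGaussianProcess.comp_right (bernstein.z (n := n))).hasGaussianLaw Finset.univ
  have h' := h.map (∑ k : (Finset.univ : Finset (Fin (n + 1))),
    (ContinuousLinearMap.proj k : (_ → ℝ) →L[ℝ] ℝ).smulRight (bernstein n k.1))
  convert! h'.isGaussian_map using 2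
  ext1 ω
  rw [bernsteinApproximation_eq_sum_smul, ← Finset.sum_coe_sort Finset.univ]
  simp

lemma integral_strongDual_map_bernsteinApproximation (hW : IsWienerMeasure W) (n : ℕ)
    (L : StrongDual ℝ C(I, ℝ)) : ∫ x, L x ∂(W.map (bernsteinApproximation n)) = 0 := by
  rw [integral_map (continuous_bernsteinApproximation n).aemeasurable (by fun_prop)]
  simp only [bernsteinApproximation_eq_sum_smul, map_sum, map_smul, smul_eq_mul]
  rw [integral_finsetSum _ fun k _ ↦
    ((hW.isGaussianProcess.hasGaussianLaw_eval _).integrable.mul_const _)]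
  simp [integral_mul_const, hW.integral_eval]

lemma exists_integrable_exp_sq_norm (hW : IsWienerMeasure W) :
    ∃ C, 0 < C ∧ Integrable (fun ω : C(I, ℝ) ↦ Real.exp (C * ‖ω‖ ^ 2)) W := by
  have := hW.isProbabilityMeasure
  refine exists_integrable_exp_sq_of_map_rotation_eq_self
    (map_rotation_prod_eq_self_of_tendsto
      (fun n ↦ (continuous_bernsteinApproximation n).measurable)
      bernsteinApproximation_uniform fun n ↦ ?_)
  have := hW.isGaussian_map_bernsteinApproximation n
  exact IsGaussian.map_rotation_eq_self_of_forall_strongDual_eq_zero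
    (hW.integral_strongDual_map_bernsteinApproximation n) _

lemma integrable_exp_mul_norm (hW : IsWienerMeasure W) (K : ℝ) :
    Integrable (fun ω : C(I, ℝ) ↦ Real.exp (K * ‖ω‖)) W := by
  obtain ⟨C, hC, hint⟩ := hW.exists_integrable_exp_sq_norm
  -- Completing the square: `K * x ≤ K ^ 2 / (4 * C) + C * x ^ 2`.
  refine (hint.const_mul (Real.exp (K ^ 2 / (4 * C)))).mono' (by fun_prop)
    (ae_of_all _ fun ω ↦ ?_)
  rw [Real.norm_of_nonneg (Real.exp_pos _).le, ← Real.exp_add]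
  gcongr
  have h : K ^ 2 / (4 * C) + C * ‖ω‖ ^ 2 - K * ‖ω‖ = (K - 2 * C * ‖ω‖) ^ 2 / (4 * C) := by
    field_simp
    ring
  have : 0 ≤ (K - 2 * C * ‖ω‖) ^ 2 / (4 * C) := by positivity
  linarith

end IsWienerMeasure

lemma continuous_iInf_eval : Continuous (fun ω : C(I, ℝ) ↦ ⨅ t : I, ω t) := by
  have h : LipschitzWith 1 (fun ω : C(I, ℝ) ↦ ⨅ t : I, ω t) := by
    refine LipschitzWith.of_le_add fun f g ↦ ?_
    rw [← sub_le_iff_le_add]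
    refine le_ciInf fun t ↦ ?_
    have h₁ : ⨅ t : I, f t ≤ f t := ciInf_le (isCompact_range f.continuous).bddBelow t
    have h₂ := (Real.dist_eq _ _ ▸ ContinuousMap.dist_apply_le_dist (f := f) (g := g) t)
    linarith [le_abs_self (f t - g t)]
  exact h.continuous

lemma continuous_etaExponent (a c : ℝ) : Continuous (etaExponent a c) := by
  have := continuous_iInf_eval
  unfold etaExponent
  fun_prop

lemma abs_iInf_eval_le_norm (ω : C(I, ℝ)) : |⨅ t : I, ω t| ≤ ‖ω‖ := by
  obtain ⟨t, ht⟩ := (isCompact_range ω.continuous).sInf_mem (Set.range_nonempty ω)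
  rw [iInf, ← ht]
  exact ω.norm_coe_le_norm t

lemma etaExponent_le (a c : ℝ) (ω : C(I, ℝ)) :
    etaExponent a c ω ≤ (2 * |a| + |c|) * ‖ω‖ := by
  have h₁ : (a + c) * (⨅ t : I, ω t) ≤ (|a| + |c|) * ‖ω‖ :=
    (le_abs_self _).trans <| by
      rw [abs_mul]
      exact mul_le_mul (abs_add_le a c) (abs_iInf_eval_le_norm ω) (abs_nonneg _) (by positivity)
  have h₂ : -(a * ω 1) ≤ |a| * ‖ω‖ :=
    (neg_le_abs _).trans <| by
      rw [abs_mul]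
      exact mul_le_mul_of_nonneg_left (ω.norm_coe_le_norm 1) (abs_nonneg a)
  unfold etaExponent
  linarith

lemma neg_sum_mul_eval_le {ι : Type*} [Fintype ι] (t : ι → I) (v : ι → ℝ) (ω : C(I, ℝ)) :
    -∑ k, v k * ω (t k) ≤ (∑ k, |v k|) * ‖ω‖ := by
  rw [Finset.sum_mul, ← Finset.sum_neg_distrib]
  refine Finset.sum_le_sum fun k _ ↦ (neg_le_abs _).trans ?_
  rw [abs_mul]
  exact mul_le_mul_of_nonneg_left (ω.norm_coe_le_norm _) (abs_nonneg _)

namespace IsWienerMeasure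

variable {W : Measure C(I, ℝ)} {g : C(I, ℝ) → ℝ} {M : ℝ}

/-- Taking `g = 0` gives the normalising constant, and `g ω = -∑ k, v k * ω (t k)` the numerator. -/
lemma integrable_exp_etaExponent_add (hW : IsWienerMeasure W) (hg : Continuous g)
    (hM : ∀ ω, g ω ≤ M * ‖ω‖) (a c : ℝ) :
    Integrable (fun ω ↦ Real.exp (etaExponent a c ω + g ω)) W := by
  have := continuous_etaExponent a c
  refine (hW.integrable_exp_mul_norm (2 * |a| + |c| + M)).mono' (by fun_prop)
    (ae_of_all _ fun ω ↦ ?_)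
  rw [Real.norm_of_nonneg (Real.exp_pos _).le, add_mul]
  gcongr
  exacts [etaExponent_le a c ω, hM ω]

lemma continuous_integral_exp_etaExponent_add (hW : IsWienerMeasure W) (hg : Continuous g)
    (hM : ∀ ω, g ω ≤ M * ‖ω‖) :
    Continuous (fun p : ℝ × ℝ ↦ ∫ ω, Real.exp (etaExponent p.1 p.2 ω + g ω) ∂W) := by
  refine continuous_iff_continuousAt.2 fun p₀ ↦ ?_
  -- The slack of `1` in the growth rate allows a single dominating function for all `p` near `p₀`.
  have hnhds : ∀ᶠ p : ℝ × ℝ in 𝓝 p₀, 2 * |p.1| + |p.2| < 2 * |p₀.1| + |p₀.2| + 1 :=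
    (by fun_prop : Continuous fun p : ℝ × ℝ ↦ 2 * |p.1| + |p.2|).continuousAt.eventually_lt_const
      (lt_add_one _)
  refine continuousAt_of_dominated
    (bound := fun ω ↦ Real.exp ((2 * |p₀.1| + |p₀.2| + 1 + M) * ‖ω‖))
    (Eventually.of_forall fun p ↦
      (hW.integrable_exp_etaExponent_add hg hM p.1 p.2).aestronglyMeasurable) ?_
    (hW.integrable_exp_mul_norm _) (ae_of_all _ fun ω ↦ ?_)
  · filter_upwards [hnhds] with p hp
    refine ae_of_all _ fun ω ↦ ?_
    rw [Real.norm_of_nonneg (Real.exp_pos _).le, add_mul _ M]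
    gcongr
    · exact (etaExponent_le p.1 p.2 ω).trans (by gcongr)
    · exact hM ω
  · unfold etaExponent
    fun_prop

lemma integrable_exp_etaExponent (hW : IsWienerMeasure W) (a c : ℝ) :
    Integrable (fun ω ↦ Real.exp (etaExponent a c ω)) W := by
  simpa using hW.integrable_exp_etaExponent_add (g := 0) (M := 0) continuous_zero (by simp) a c

end IsWienerMeasure

theorem proposition3p3 (W : Measure C(I, ℝ)) (hW : IsWienerMeasure W)
    (d : ℕ) (t : Fin (d + 1) → I) (ht_pos : 0 < t 0) (ht_mono : StrictMono t)
    (ht_last : t (Fin.last d) = 1) (v : Fin (d + 1) → ℝ) :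
    (∀ a c : ℝ, IsProbabilityMeasure (etaLaw W a c) ∧
      Integrable (fun ω : C(I, ℝ) => Real.exp (-∑ k, v k * ω (t k))) (etaLaw W a c)) ∧
    Continuous (fun p : ℝ × ℝ => etaLaplace W t v p.1 p.2) := by
  have := hW.isProbabilityMeasure
  have hcont : Continuous fun ω : C(I, ℝ) ↦ -∑ k, v k * ω (t k) := by fun_prop
  refine ⟨fun a c ↦ ⟨isProbabilityMeasure_tilted (hW.integrable_exp_etaExponent a c), ?_⟩, ?_⟩
  · rw [etaLaw, integrable_tilted_iff (hW.integrable_exp_etaExponent a c)]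
    simpa only [smul_eq_mul, ← Real.exp_add] using
      hW.integrable_exp_etaExponent_add hcont (neg_sum_mul_eval_le t v) a c
  · have hden : Continuous fun p : ℝ × ℝ ↦ ∫ ω, Real.exp (etaExponent p.1 p.2 ω) ∂W := by
      simpa using hW.continuous_integral_exp_etaExponent_add (g := 0) (M := 0) continuous_zero
        (by simp)
    simp_rw [etaLaplace, etaLaw, integral_exp_tilted]
    exact (hW.continuous_integral_exp_etaExponent_add hcont (neg_sum_mul_eval_le t v)).div hden
      fun p ↦ (integral_exp_pos (hW.integrable_exp_etaExponent p.1 p.2)).ne'
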